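/- Let $\mathbb H=\{z\in\mathbb C:\operatorname{Im} z\ge 0\}$. For a polynomial $p$ that is not identically $0$ let $\mathcal Z(p)=\{z\in\mathbb C: p(z)=0\}$, and let $\mathcal Z(0)=\emptyset$. The Pólya–Obrechkoff class $\mathcal{PO}$ is the collection of entire functions of the form $$F(z)=c\,z^m e^{-\alpha z^2+\beta z}\prod_j\Bigl(1-\frac z{a_j}\Bigr)e^{z/a_j}\qquad(z\in\mathbb C),$$ where $c,\beta\in\mathbb C$ ($c=0$ is allowed), $m$ is a nonnegative integer, $\alpha\ge 0$, $(a_j)$ is a finite (possibly empty) or infinite sequence in $\mathbb H\setminus\{0\}$, $\sum_j|a_j|^{-2}<\infty$ and $\sum_j\operatorname{Im}(-a_j^{-1})\le\operatorname{Im}\beta$. Let $f(z)=\sum_{k\ge 0}a_kz^k$ be a formal power series with complex coefficients $a_k$. For $n=0,1,2,\dots$ let $$J(f,n)(z)=\sum_{k=0}^n\frac{n!}{(n-k)!}\,a_k z^k$$ be its $n$-th Jensen polynomial. Say that a sequence $(f_i)$ of polynomials converges weakly to $f$ if $\frac1{k!}f_i^{(k)}(0)\to a_k$ as $i\to\infty$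 for every $k\ge 0$. Theorem 3.3. The following are equivalent: 1. $f$ represents an entire function in $\mathcal{PO}$; that is, there is $F\in\mathcal{PO}$ such that $\sum_k a_kz^k$ converges to $F(z)$ for every $z\in\mathbb C$. 2. There is a sequence $(f_i)$ of complex polynomials that converges weakly to $f$ and satisfies $\mathcal Z(f_i)\subset\mathbb H$ for all $i$. 3. $\mathcal Z(J(f,n))\subset\mathbb H$ for all $n\ge 0$. -/

import Mathlib

open Filter Topology
open scoped Nat

/-- The closed upper half plane `{z | Im z ≥ 0}`. -/
def closedUpperHalfPlane : Set ℂ := {z : ℂ | 0 ≤ z.im}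

/-- The zero set of a complex function, with the convention that the zero set of the
function that is identically `0` is empty. -/
def zeroSet (f : ℂ → ℂ) : Set ℂ := {z : ℂ | f z = 0 ∧ ∃ w : ℂ, f w ≠ 0}

/-- The Pólya-Obrechkoff class: the entire functions of the form
`c z ^ m exp (-α z ^ 2 + β z) ∏ j, (1 - z / a j) exp (z / a j)`
with `c` a complex constant (`c = 0` is allowed), `α ≥ 0`, finitely or countably many `a j`
that are nonzero and lie in the closed upper half plane (repetitions allowed),
`∑ j, |a j| ^ (-2) < ∞` and `∑ j, Im (-1 / a j) ≤ Im β`.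
The terms of the last sum are nonnegative, so that this inequality contains the convergence
of the sum, which is spelled out here. -/
def PolyaObrechkoff : Set (ℂ → ℂ) :=
  {f : ℂ → ℂ | Differentiable ℂ f ∧
    ∃ (c : ℂ) (m : ℕ) (α : ℝ) (β : ℂ) (ι : Type) (_ : Countable ι) (a : ι → ℂ),
      0 ≤ α ∧
      (∀ j, a j ∈ closedUpperHalfPlane \ {0}) ∧
      Summable (fun j => (‖a j‖ ^ 2)⁻¹) ∧
      Summable (fun j => (-(a j)⁻¹).im) ∧
      ∑' j, (-(a j)⁻¹).im ≤ β.im ∧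
      ∀ z : ℂ, ∃ P : ℂ,
        HasProd (fun j => (1 - z / a j) * Complex.exp (z / a j)) P ∧
        f z = c * z ^ m * Complex.exp (-(α : ℂ) * z ^ 2 + β * z) * P}

/-- The formal power series `f` represents the function `F` on the whole complex plane (so that
its radius of convergence is infinite). -/
def Represents (f : PowerSeries ℂ) (F : ℂ → ℂ) : Prop :=
  ∀ z : ℂ, HasSum (fun k : ℕ => PowerSeries.coeff k f * z ^ k) (F z)

/-- Weak convergence of a sequence of functions to a formal power series: for every `k`,
the `k`-th coefficient of the series is `(1 / k!) lim F_n ^ (k) (0)`, the limit being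
understood to exist. -/
def ConvergesWeakly (F : ℕ → ℂ → ℂ) (f : PowerSeries ℂ) : Prop :=
  ∀ k : ℕ, Tendsto (fun n : ℕ => 1 / (k ! : ℂ) * iteratedDeriv k (F n) 0) atTop
    (𝓝 (PowerSeries.coeff k f))

/-- The `n`-th Jensen polynomial `∑ k ≤ n, (n! / (n - k)!) a_k z ^ k` of the formal power
series `∑ k, a_k z ^ k`. -/
noncomputable def jensenPolynomial (f : PowerSeries ℂ) (n : ℕ) : Polynomial ℂ :=
  ∑ k ∈ Finset.range (n + 1),
    Polynomial.C ((n ! : ℂ) / ((n - k)! : ℂ) * PowerSeries.coeff k f) * Polynomial.X ^ k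

/-! From 1 to 2: a partial product of $F$ is a polynomial times $e^{-\alpha z^2+\gamma z}$, where
$\operatorname{Im}\gamma\ge 0$ is exactly what the condition on $\beta$ provides. Powers $(1-\alpha
z^2/n)^n$ and $(1+\gamma z/n)^n$ approximate the exponentials
(`taylorCoeff_mem_closure_of_mem_PolyaObrechkoff`).

From 2 to 3: with $D=d/dz$, $J(p,n)(z)=z^n\,(p(D)X^n)(1/z)$. The operator $p(D)$ is a constant times
a product of $D-a$ with $\operatorname{Im}a\ge 0$, and by a Gauss–Lucas argument each of these
creates no root in the open upper half plane (`lowerRoots_derivative_sub`). Inversion exchanges the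
half planes, and a Hurwitz argument in bounded degree passes from $J(f_i,n)$ to $J(f,n)$.

From 3 to 1: $J(f,n)(z/n)$ converges weakly to $f$. Normalised to constant term 1, an approximant is
$\prod(1+w_jz)$ with $\operatorname{Im}w_j\ge 0$. Its coefficients of degree 1 and 2 determine $\sum
w_j$ and $\sum w_j^2$, and positivity of $\operatorname{Im}w_j$ turns these into a bound for
$\sum|w_j|^2$ (`sum_norm_sq_le`). This yields local bounds, hence an entire limit, and a subsequence
along which every $w_j$ converges. What $\sum w_j^2$ loses in the limit is real and nonnegative and
becomes $2\alpha$ (`exists_nonneg_eq_sub_tsum_sq`); a loss in $\sum\operatorname{Im}w_j$ accounts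
for the inequality on $\beta$. -/

/-! ### Polynomials without roots in the open lower half plane -/

open Polynomial in
/-- A complex polynomial that is `0` or has no root in the open lower half plane. -/
def UpperRoots (p : ℂ[X]) : Prop := ∀ z : ℂ, z.im < 0 → p.eval z = 0 → p = 0

open Polynomial in
theorem zeroSet_eval_subset_iff (p : ℂ[X]) :
    zeroSet (fun z => p.eval z) ⊆ closedUpperHalfPlane ↔ UpperRoots p := by
  constructor
  · intro h z hz hp
    by_contra hne
    have : ∃ w, p.eval w ≠ 0 := by
      by_contra! hcon
      exact hne (Polynomial.funext fun w => by simpa using hcon w)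
    have h1 : 0 ≤ z.im := h ⟨hp, this⟩
    linarith
  · rintro h z ⟨hz, w, hw⟩
    by_contra hcon
    have h0 : p = 0 := h z (not_le.mp hcon) hz
    simp [h0] at hw

open Polynomial in
theorem iteratedDeriv_eval (p : ℂ[X]) (k : ℕ) :
    iteratedDeriv k (fun z => p.eval z) = fun z => (derivative^[k] p).eval z := by
  induction k with
  | zero => simp
  | succ k ih =>
    rw [iteratedDeriv_succ, ih, Function.iterate_succ_apply']
    ext z
    exact Polynomial.deriv _

open Polynomial in
theorem taylorCoeff_eval (p : ℂ[X]) (k : ℕ) :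
    1 / (k ! : ℂ) * iteratedDeriv k (fun z => p.eval z) 0 = p.coeff k := by
  rw [iteratedDeriv_eval]
  beta_reduce
  rw [← coeff_zero_eq_eval_zero, coeff_iterate_derivative]
  have : (k ! : ℂ) ≠ 0 := by exact_mod_cast k.factorial_ne_zero
  simp [Nat.descFactorial_self]
  field_simp

open Polynomial in
theorem UpperRoots.mul {p q : ℂ[X]} (hp : UpperRoots p) (hq : UpperRoots q) :
    UpperRoots (p * q) := by
  intro z hz h
  rw [eval_mul, mul_eq_zero] at h
  rcases h with h | h
  · rw [hp z hz h, zero_mul]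
  · rw [hq z hz h, mul_zero]

open Polynomial in
theorem UpperRoots.const (c : ℂ) : UpperRoots (C c) := by
  intro z hz h
  simpa using h

open Polynomial in
theorem UpperRoots.pow {p : ℂ[X]} (hp : UpperRoots p) (n : ℕ) : UpperRoots (p ^ n) := by
  induction n with
  | zero => simpa using UpperRoots.const 1
  | succ n ih => rw [pow_succ]; exact ih.mul hp

open Polynomial in
theorem UpperRoots.prod {ι : Type*} (s : Finset ι) (p : ι → ℂ[X])
    (h : ∀ i ∈ s, UpperRoots (p i)) : UpperRoots (∏ i ∈ s, p i) :=
  Finset.prod_induction p UpperRoots (fun _ _ => UpperRoots.mul)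
    (by simpa using UpperRoots.const 1) h

open Polynomial in
theorem UpperRoots.one_add_C_mul_X {w : ℂ} (hw : 0 ≤ w.im) :
    UpperRoots (1 + Polynomial.C w * X) := by
  intro z hz h
  exfalso
  simp only [eval_add, eval_one, eval_mul, eval_C, eval_X] at h
  have hw0 : w ≠ 0 := by rintro rfl; simp at h
  have hz' : z = -w⁻¹ := by
    field_simp
    linear_combination h
  rw [hz'] at hz
  simp only [Complex.neg_im, Complex.inv_im] at hz
  have : 0 ≤ w.im / Complex.normSq w := div_nonneg hw (Complex.normSq_nonneg _)
  rw [neg_div, neg_neg] at hz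
  linarith

open Polynomial in
-- Each linear factor grows by at most $1+|z-z_0|/\delta$ from $z_0$ to $z$. A polynomial that is
-- small at a point far from its roots is thus small everywhere, which replaces Hurwitz's theorem in
-- bounded degree.
theorem norm_eval_le_of_dist_roots (p : ℂ[X]) {z₀ : ℂ} {δ : ℝ} (hδ : 0 < δ)
    (h : ∀ r ∈ p.roots, δ ≤ ‖z₀ - r‖) {n : ℕ} (hn : p.natDegree ≤ n) (z : ℂ) :
    ‖p.eval z‖ ≤ ‖p.eval z₀‖ * (1 + ‖z - z₀‖ / δ) ^ n := by
  have hev (x : ℂ) : p.eval x = p.leadingCoeff * (p.roots.map fun r => x - r).prod := by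
    conv_lhs => rw [(IsAlgClosed.splits p).eq_prod_roots]
    simp [eval_multiset_prod]
  have key : ∀ s : Multiset ℂ, (∀ r ∈ s, δ ≤ ‖z₀ - r‖) →
      ‖(s.map fun r => z - r).prod‖ ≤
        ‖(s.map fun r => z₀ - r).prod‖ * (1 + ‖z - z₀‖ / δ) ^ s.card := by
    intro s
    induction s using Multiset.induction with
    | empty => simp
    | cons a s ih =>
      intro hs
      have h1 := ih fun r hr => hs r (Multiset.mem_cons_of_mem hr)
      have h2 : δ ≤ ‖z₀ - a‖ := hs a (Multiset.mem_cons_self a s)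
      have h3 : ‖z - a‖ ≤ ‖z₀ - a‖ * (1 + ‖z - z₀‖ / δ) := by
        have h4 : ‖z - a‖ ≤ ‖z - z₀‖ + ‖z₀ - a‖ := norm_sub_le_norm_sub_add_norm_sub _ _ _
        have h5 : ‖z - z₀‖ ≤ ‖z₀ - a‖ * (‖z - z₀‖ / δ) := by
          rw [mul_div_assoc', le_div_iff₀ hδ, mul_comm]
          gcongr
        linarith
      simp only [Multiset.map_cons, Multiset.prod_cons, norm_mul, Multiset.card_cons, pow_succ]
      calc _ ≤ (‖z₀ - a‖ * (1 + ‖z - z₀‖ / δ)) *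
            (‖(s.map fun r => z₀ - r).prod‖ * (1 + ‖z - z₀‖ / δ) ^ s.card) := by gcongr
        _ = _ := by ring
  rw [hev z, hev z₀, norm_mul, norm_mul, mul_assoc]
  gcongr
  refine (key _ h).trans ?_
  gcongr
  · exact le_add_of_nonneg_right (by positivity)
  · exact (card_roots' p).trans hn

open Polynomial in
/-- The polynomials without roots in the open lower half plane, together with `0`, are closed
under coefficientwise limits of bounded degree. -/
theorem UpperRoots.of_tendsto {p : ℕ → ℂ[X]} {q : ℂ[X]} {n : ℕ} (hp : ∀ i, UpperRoots (p i))
    (hn : ∀ i, (p i).natDegree ≤ n) (hq : q.natDegree ≤ n)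
    (h : ∀ k, Tendsto (fun i => (p i).coeff k) atTop (𝓝 (q.coeff k))) : UpperRoots q := by
  intro z₀ hz₀ hz
  have hlim (z : ℂ) : Tendsto (fun i => (p i).eval z) atTop (𝓝 (q.eval z)) := by
    simp_rw [fun i => eval_eq_sum_range' (Nat.lt_succ_of_le (hn i)) z,
      eval_eq_sum_range' (Nat.lt_succ_of_le hq) z]
    exact tendsto_finsetSum _ fun k _ => (h k).mul_const _
  have hδ : 0 < -z₀.im := by linarith
  refine Polynomial.funext fun z => ?_
  have hle (i : ℕ) : ‖(p i).eval z‖ ≤ ‖(p i).eval z₀‖ * (1 + ‖z - z₀‖ / (-z₀.im)) ^ n := by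
    refine norm_eval_le_of_dist_roots (p i) hδ (fun r hr => ?_) (hn i) z
    have hr' : 0 ≤ r.im := by
      by_contra! hneg
      exact (ne_zero_of_mem_roots hr) (hp i r hneg (isRoot_of_mem_roots hr))
    have := Complex.abs_im_le_norm (z₀ - r)
    rw [Complex.sub_im] at this
    linarith [neg_le_abs (z₀.im - r.im)]
  have := le_of_tendsto_of_tendsto' (hlim z).norm ((hlim z₀).norm.mul_const _) hle
  rw [hz, norm_zero, zero_mul] at this
  simpa using this

/-! ### Differential operators and Jensen polynomials -/

open Polynomial in
-- Above all the roots of $q$, every term of $q'/q=\sum 1/(z-r)$ has negative imaginary part, so the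
-- sum cannot equal $a$ unless it is empty.
theorem lowerRoots_derivative_sub {q : ℂ[X]} (hq : ∀ z : ℂ, 0 < z.im → q.eval z = 0 → q = 0)
    {a : ℂ} (ha : 0 ≤ a.im) (z : ℂ) (hz : 0 < z.im)
    (h : (derivative q - C a * q).eval z = 0) : derivative q - C a * q = 0 := by
  by_cases hq0 : q = 0
  · simp [hq0]
  have hqz : q.eval z ≠ 0 := fun h => hq0 (hq z hz h)
  have hroots : ∀ r ∈ q.roots, r.im ≤ 0 := by
    intro r hr
    by_contra! hpos
    exact hq0 (hq r hpos (isRoot_of_mem_roots hr))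
  have h1 := (IsAlgClosed.splits q).eval_derivative_div_eval_of_ne_zero hqz
  have h2 : (derivative q).eval z / q.eval z = a := by
    rw [div_eq_iff hqz]
    simpa [sub_eq_zero] using h
  rw [h2] at h1
  have him (r : ℂ) (hr : r ∈ q.roots) : (1 / (z - r)).im < 0 := by
    have h3 : 0 < (z - r).im := by
      have := hroots r hr
      simp only [Complex.sub_im]
      linarith
    have h4 : 0 < Complex.normSq (z - r) := by
      rw [Complex.normSq_pos]
      intro h0
      simp [h0] at h3
    rw [one_div, Complex.inv_im]
    exact div_neg_of_neg_of_pos (by linarith) h4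
  have hsum : a.im = (q.roots.map fun r => (1 / (z - r)).im).sum := by
    rw [h1]
    simpa [Multiset.map_map, Function.comp_def] using
      map_multiset_sum Complex.imAddGroupHom (q.roots.map fun r => 1 / (z - r))
  by_cases hr : q.roots = 0
  · have hdeg : q.natDegree = 0 := by
      have := (IsAlgClosed.splits q).natDegree_eq_card_roots
      simpa [hr] using this
    rw [eq_C_of_natDegree_eq_zero hdeg] at h ⊢
    have ha0 : a = 0 := by rw [h1, hr]; simp
    simp [ha0]
  · exfalso
    have : (q.roots.map fun r => (1 / (z - r)).im).sum < (q.roots.map fun _ => (0 : ℝ)).sum :=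
      Multiset.sum_lt_sum_of_nonempty hr him
    simp at this
    simp at hsum
    linarith

open Polynomial in
theorem lowerRoots_aeval_derivative {p : ℂ[X]} (hp : UpperRoots p) {q : ℂ[X]}
    (hq : ∀ z : ℂ, 0 < z.im → q.eval z = 0 → q = 0) (z : ℂ) (hz : 0 < z.im)
    (h : (aeval (derivative : Module.End ℂ ℂ[X]) p q).eval z = 0) :
    aeval (derivative : Module.End ℂ ℂ[X]) p q = 0 := by
  have key : ∀ s : Multiset ℂ, (∀ r ∈ s, 0 ≤ r.im) → ∀ z : ℂ, 0 < z.im →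
      (aeval (derivative : Module.End ℂ ℂ[X]) (s.map fun a => X - C a).prod q).eval z = 0 →
      aeval (derivative : Module.End ℂ ℂ[X]) (s.map fun a => X - C a).prod q = 0 := by
    intro s
    induction s using Multiset.induction with
    | empty => simpa using hq
    | cons a s ih =>
      intro hs
      have h1 := ih fun r hr => hs r (Multiset.mem_cons_of_mem hr)
      have h2 := lowerRoots_derivative_sub h1 (hs a (Multiset.mem_cons_self a s))
      simpa [Module.algebraMap_end_apply, smul_eq_C_mul] using h2
  by_cases hp0 : p = 0
  · simp [hp0]
  rw [(IsAlgClosed.splits p).eq_prod_roots] at h ⊢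
  have hc : p.leadingCoeff ≠ 0 := leadingCoeff_ne_zero.mpr hp0
  simp only [map_mul, aeval_C, Module.End.mul_apply, Module.algebraMap_end_apply, eval_smul,
    smul_eq_mul, mul_eq_zero, hc, false_or, smul_eq_zero] at h ⊢
  refine key _ (fun r hr => ?_) z hz h
  by_contra! hneg
  exact hp0 (hp r hneg (isRoot_of_mem_roots hr))

theorem jensenPolynomial_coeff (f : PowerSeries ℂ) (n k : ℕ) :
    (jensenPolynomial f n).coeff k =
      if k ≤ n then (n ! : ℂ) / ((n - k)! : ℂ) * PowerSeries.coeff k f else 0 := by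
  simp only [jensenPolynomial, Polynomial.finsetSum_coeff, Polynomial.coeff_C_mul_X_pow]
  simp

theorem jensenPolynomial_natDegree_le (f : PowerSeries ℂ) (n : ℕ) :
    (jensenPolynomial f n).natDegree ≤ n := by
  rw [Polynomial.natDegree_le_iff_coeff_eq_zero]
  intro k hk
  rw [jensenPolynomial_coeff, if_neg (not_le.mpr hk)]

open Polynomial in
-- The factor $n!/(n-k)!$ is the one in $D^kX^n$, so the Jensen polynomial is the reversal of
-- $p(D)X^n$.
theorem jensenPolynomial_eval_eq (p : ℂ[X]) (n : ℕ) {z : ℂ} (hz : z ≠ 0) :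
    (jensenPolynomial (p : PowerSeries ℂ) n).eval z =
      z ^ n * (aeval (derivative : Module.End ℂ ℂ[X]) p (X ^ n)).eval z⁻¹ := by
  have h1 : aeval (derivative : Module.End ℂ ℂ[X]) p (X ^ n) =
      ∑ k ∈ Finset.range (max n p.natDegree + 1), C (p.coeff k) * derivative^[k] (X ^ n) := by
    rw [aeval_eq_sum_range' (n := max n p.natDegree + 1) (by omega)]
    simp [LinearMap.sum_apply, smul_eq_C_mul, Module.End.pow_apply]
  have h2 : (jensenPolynomial (p : PowerSeries ℂ) n).eval z =
      ∑ k ∈ Finset.range (max n p.natDegree + 1),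
        (jensenPolynomial (p : PowerSeries ℂ) n).coeff k * z ^ k :=
    eval_eq_sum_range' (by have := jensenPolynomial_natDegree_le p n; omega) z
  rw [h1, h2, eval_finsetSum, Finset.mul_sum]
  refine Finset.sum_congr rfl fun k _ => ?_
  rw [jensenPolynomial_coeff, iterate_derivative_X_pow_eq_C_mul]
  simp only [eval_mul, eval_C, eval_pow, eval_X, Polynomial.coeff_coe]
  split_ifs with hk
  · obtain ⟨l, rfl⟩ := Nat.exists_eq_add_of_le hk
    have hd : ((k + l).descFactorial k : ℂ) = ((k + l)! : ℂ) / ((k + l - k)! : ℂ) := by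
      rw [eq_div_iff (by exact_mod_cast Nat.factorial_ne_zero _), mul_comm]
      exact_mod_cast Nat.factorial_mul_descFactorial hk
    rw [hd, Nat.add_sub_cancel_left, inv_pow, pow_add]
    field_simp
  · simp [Nat.descFactorial_of_lt (not_le.mp hk)]

open Polynomial in
theorem UpperRoots.jensenPolynomial {p : ℂ[X]} (hp : UpperRoots p) (n : ℕ) :
    UpperRoots (jensenPolynomial (p : PowerSeries ℂ) n) := by
  intro z hz h
  have hz0 : z ≠ 0 := by rintro rfl; simp at hz
  rw [jensenPolynomial_eval_eq p n hz0, mul_eq_zero] at h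
  have h1 := h.resolve_left (pow_ne_zero n hz0)
  have hzi : 0 < (z⁻¹).im := by
    rw [Complex.inv_im]
    exact div_pos (by linarith) (Complex.normSq_pos.mpr hz0)
  have hX : ∀ w : ℂ, 0 < w.im → (X ^ n : ℂ[X]).eval w = 0 → (X ^ n : ℂ[X]) = 0 := by
    intro w hw h
    rw [eval_pow, eval_X] at h
    rw [pow_eq_zero_iff'.mp h |>.1] at hw
    simp at hw
  have h2 := lowerRoots_aeval_derivative hp hX z⁻¹ hzi h1
  -- The reversal formula needs a nonzero argument; vanishing off 0 suffices.
  refine eq_zero_of_infinite_isRoot _ ((Set.finite_singleton (0 : ℂ)).infinite_compl.mono ?_)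
  intro w hw
  change (_root_.jensenPolynomial (p : PowerSeries ℂ) n).eval w = 0
  rw [jensenPolynomial_eval_eq p n hw, h2, eval_zero, mul_zero]

open Polynomial in
theorem upperRoots_jensenPolynomial_of_tendsto {f : PowerSeries ℂ} {p : ℕ → ℂ[X]}
    (hp : ∀ i, UpperRoots (p i))
    (h : ∀ k, Tendsto (fun i => (p i).coeff k) atTop (𝓝 (PowerSeries.coeff k f))) (n : ℕ) :
    UpperRoots (jensenPolynomial f n) := by
  refine UpperRoots.of_tendsto (fun i => (hp i).jensenPolynomial n)
    (fun i => jensenPolynomial_natDegree_le _ n) (jensenPolynomial_natDegree_le _ n) fun k => ?_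
  simp only [jensenPolynomial_coeff, Polynomial.coeff_coe]
  split_ifs
  · exact (h k).const_mul _
  · exact tendsto_const_nhds

theorem tendsto_factorial_div_factorial_mul_pow (k : ℕ) :
    Tendsto (fun n : ℕ => ((n ! : ℂ) / ((n - k)! : ℂ)) / (n : ℂ) ^ k) atTop (𝓝 1) := by
  induction k with
  | zero =>
    refine tendsto_const_nhds.congr fun n => ?_
    have : (n ! : ℂ) ≠ 0 := by exact_mod_cast n.factorial_ne_zero
    simp [this]
  | succ k ih =>
    have h1 : Tendsto (fun n : ℕ => 1 - (k : ℂ) * (n : ℂ)⁻¹) atTop (𝓝 1) := by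
      have := (tendsto_inv_atTop_nhds_zero_nat (𝕜 := ℂ)).const_mul (k : ℂ)
      simpa using this.const_sub 1
    have h2 := ih.mul h1
    rw [mul_one] at h2
    refine h2.congr' ?_
    filter_upwards [eventually_ge_atTop (k + 1)] with n hn
    obtain ⟨l, rfl⟩ := Nat.exists_eq_add_of_le hn
    have h3 : k + 1 + l - k = l + 1 := by omega
    have h4 : (l ! : ℂ) ≠ 0 := by exact_mod_cast l.factorial_ne_zero
    have h5 : (l : ℂ) + 1 ≠ 0 := by exact_mod_cast l.succ_ne_zero
    have h6 : (k : ℂ) + 1 + l ≠ 0 := by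
      have : ((k + 1 + l : ℕ) : ℂ) ≠ 0 := by
        rw [Nat.cast_ne_zero]; omega
      push_cast at this
      exact this
    rw [h3, Nat.add_sub_cancel_left, Nat.factorial_succ l]
    push_cast
    field_simp
    ring

open Polynomial in
theorem exists_tendsto_of_upperRoots_jensenPolynomial {f : PowerSeries ℂ}
    (h : ∀ n, UpperRoots (jensenPolynomial f n)) :
    ∃ p : ℕ → ℂ[X], (∀ i, UpperRoots (p i)) ∧
      ∀ k, Tendsto (fun i => (p i).coeff k) atTop (𝓝 (PowerSeries.coeff k f)) := by
  refine ⟨fun n => (jensenPolynomial f n).comp (C (n : ℂ)⁻¹ * X), fun n z hz hev => ?_,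
    fun k => ?_⟩
  -- For $n=0$ the scaling factor is $0^{-1}=0$, but the polynomial is constant anyway.
  · rcases Nat.eq_zero_or_pos n with rfl | hn
    · simp at hev
      simp [hev]
    · have h2 : ((n : ℂ)⁻¹ * z).im < 0 := by
        have : ((n : ℂ)⁻¹ * z).im = (n : ℝ)⁻¹ * z.im := by
          rw [← Complex.ofReal_natCast, ← Complex.ofReal_inv, Complex.im_ofReal_mul]
        rw [this]
        exact mul_neg_of_pos_of_neg (by positivity) hz
      rw [eval_comp, eval_mul, eval_C, eval_X] at hev
      beta_reduce
      rw [h n _ h2 hev, zero_comp]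
  · have h1 := (tendsto_factorial_div_factorial_mul_pow k).mul_const (PowerSeries.coeff k f)
    rw [one_mul] at h1
    refine h1.congr' ?_
    filter_upwards [eventually_ge_atTop k] with n hn
    rw [comp_C_mul_X_coeff, jensenPolynomial_coeff, if_pos hn, inv_pow]
    ring

/-! ### Taylor coefficients and weak closure -/

/-- The `k`-th Taylor coefficient at `0`. -/
noncomputable def taylorCoeff (F : ℂ → ℂ) (k : ℕ) : ℂ := 1 / (k ! : ℂ) * iteratedDeriv k F 0

theorem taylorCoeff_eq_circleIntegral {F : ℂ → ℂ} (hF : Differentiable ℂ F) (k : ℕ) :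
    taylorCoeff F k =
      (2 * Real.pi * Complex.I)⁻¹ * ∮ z in C(0, 1), (1 / (z - 0) ^ (k + 1)) • F z := by
  rw [hF.differentiableOn.circleIntegral_one_div_sub_center_pow_smul one_pos k, taylorCoeff,
    smul_eq_mul]
  have := Complex.two_pi_I_ne_zero
  field_simp

/-- Entire functions that converge pointwise and boundedly on the unit circle converge
coefficientwise. -/
theorem tendsto_taylorCoeff {ι : Type*} {l : Filter ι} [l.IsCountablyGenerated]
    {G : ι → ℂ → ℂ} {F : ℂ → ℂ} (hG : ∀ i, Differentiable ℂ (G i)) (hF : Differentiable ℂ F)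
    {M : ℝ} (hM : ∀ i z, ‖z‖ = 1 → ‖G i z‖ ≤ M)
    (hlim : ∀ z, ‖z‖ = 1 → Tendsto (fun i => G i z) l (𝓝 (F z))) :
    Tendsto (fun i => taylorCoeff (G i)) l (𝓝 (taylorCoeff F)) := by
  rw [tendsto_pi_nhds]
  intro k
  simp_rw [fun i => taylorCoeff_eq_circleIntegral (hG i) k, taylorCoeff_eq_circleIntegral hF k]
  refine Tendsto.const_mul _ ?_
  have hnorm (θ : ℝ) : ‖circleMap 0 1 θ‖ = 1 := by simp
  have hne (θ : ℝ) : circleMap 0 1 θ ≠ 0 := by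
    rw [← norm_pos_iff, hnorm]; exact one_pos
  refine intervalIntegral.tendsto_integral_filter_of_dominated_convergence (fun _ => M) ?_ ?_ ?_ ?_
  · refine Eventually.of_forall fun i => Continuous.aestronglyMeasurable ?_
    have := (hG i).continuous
    simp only [deriv_circleMap, sub_zero, smul_eq_mul]
    have hc : Continuous (circleMap 0 1) := continuous_circleMap 0 1
    exact (hc.mul continuous_const).mul
      ((continuous_const.div (hc.pow _) fun θ => pow_ne_zero _ (hne θ)).mul (this.comp hc))
  · refine Eventually.of_forall fun i => MeasureTheory.ae_of_all _ fun θ _ => ?_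
    simp only [deriv_circleMap, norm_smul, norm_mul, norm_div, norm_pow, sub_zero, hnorm]
    simpa using hM i _ (hnorm θ)
  · exact intervalIntegrable_const
  · exact MeasureTheory.ae_of_all _ fun θ _ =>
      ((hlim _ (hnorm θ)).const_smul _).const_smul _

theorem taylorCoeff_of_hasSum {F : ℂ → ℂ} {a : ℕ → ℂ} (h : ∀ z, HasSum (fun k => a k * z ^ k) (F z))
    (k : ℕ) : taylorCoeff F k = a k := by
  have h1 : HasFPowerSeriesAt F (FormalMultilinearSeries.ofScalars ℂ a) 0 := by
    rw [hasFPowerSeriesAt_iff]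
    refine Eventually.of_forall fun z => ?_
    simpa [FormalMultilinearSeries.coeff_ofScalars, mul_comm] using h z
  have h2 := h1.eq_formalMultilinearSeries h1.analyticAt.hasFPowerSeriesAt
  have h3 := congrArg (fun p => p.coeff k) h2
  simp only [FormalMultilinearSeries.coeff_ofScalars] at h3
  rw [h3, taylorCoeff]
  ring

/-- The coefficient sequences of the polynomials without roots in the open lower half plane. -/
def upperRootsCoeffs : Set (ℕ → ℂ) :=
  {a | ∃ p : Polynomial ℂ, UpperRoots p ∧ ∀ k, a k = p.coeff k}

/-- Phrasing weak limits as a closure lets two successive approximations be composed without a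
diagonal argument. -/
theorem mem_closure_upperRootsCoeffs_iff (a : ℕ → ℂ) :
    a ∈ closure upperRootsCoeffs ↔ ∃ p : ℕ → Polynomial ℂ, (∀ i, UpperRoots (p i)) ∧
      ∀ k, Tendsto (fun i => (p i).coeff k) atTop (𝓝 (a k)) := by
  rw [mem_closure_iff_seq_limit]
  constructor
  · rintro ⟨x, hx, hlim⟩
    choose p hp hxp using hx
    refine ⟨p, hp, fun k => ?_⟩
    simpa only [hxp] using (tendsto_pi_nhds.mp hlim) k
  · rintro ⟨p, hp, hlim⟩
    exact ⟨fun i k => (p i).coeff k, fun i => ⟨p i, hp i, fun _ => rfl⟩, tendsto_pi_nhds.mpr hlim⟩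

/-! ### Polynomial approximation of the Pólya–Obrechkoff class -/

theorem norm_one_add_mul_exp_neg_le (u : ℂ) :
    ‖(1 + u) * Complex.exp (-u)‖ ≤ Real.exp (‖u‖ ^ 2 / 2) := by
  have h1 : ‖1 + u‖ ^ 2 ≤ Real.exp (2 * u.re + ‖u‖ ^ 2) := by
    have : ‖1 + u‖ ^ 2 = 2 * u.re + ‖u‖ ^ 2 + 1 := by
      rw [← Complex.normSq_eq_norm_sq, ← Complex.normSq_eq_norm_sq, Complex.normSq_apply,
        Complex.normSq_apply]
      simp
      ring
    rw [this]
    exact Real.add_one_le_exp _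
  rw [norm_mul, Complex.norm_exp]
  refine le_of_sq_le_sq ?_ (Real.exp_pos _).le
  calc (‖1 + u‖ * Real.exp (-u).re) ^ 2 = ‖1 + u‖ ^ 2 * Real.exp (-u).re ^ 2 := by ring
    _ ≤ Real.exp (2 * u.re + ‖u‖ ^ 2) * Real.exp (-u).re ^ 2 := by gcongr
    _ = Real.exp (‖u‖ ^ 2 / 2) ^ 2 := by
      rw [← Real.exp_nat_mul, ← Real.exp_nat_mul, ← Real.exp_add]
      congr 1
      simp
      ring

theorem norm_one_add_div_pow_le (t : ℂ) (n : ℕ) : ‖(1 + t / n) ^ n‖ ≤ Real.exp ‖t‖ := by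
  rcases Nat.eq_zero_or_pos n with rfl | hn
  · simp
  have h1 : ‖1 + t / n‖ ≤ Real.exp (‖t‖ / n) := by
    refine (norm_add_le _ _).trans ?_
    have := Real.add_one_le_exp (‖t‖ / n)
    simp only [norm_one, norm_div, Complex.norm_natCast]
    linarith
  rw [norm_pow]
  calc ‖1 + t / n‖ ^ n ≤ Real.exp (‖t‖ / n) ^ n := by gcongr
    _ = Real.exp ‖t‖ := by
      rw [← Real.exp_nat_mul]
      congr 1
      field_simp

open Polynomial in
theorem upperRoots_one_add_C_mul_X_sq {α : ℝ} (hα : 0 ≤ α) :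
    UpperRoots (1 + C (-(α : ℂ)) * X ^ 2) := by
  have h := (UpperRoots.one_add_C_mul_X (w := (√α : ℝ)) (by simp)).mul
    (UpperRoots.one_add_C_mul_X (w := -(√α : ℝ)) (by simp))
  have h2 : C ((√α : ℝ) : ℂ) ^ 2 = C (α : ℂ) := by
    rw [← C_pow, ← Complex.ofReal_pow, Real.sq_sqrt hα]
  convert h using 1
  simp only [C_neg]
  rw [← h2]
  ring

open Polynomial in
theorem taylorCoeff_finite_product_mem_closure {ι : Type*} (s : Finset ι) (w : ι → ℂ)
    (hw : ∀ j ∈ s, 0 ≤ (w j).im) (c : ℂ) (m : ℕ) {α : ℝ} (hα : 0 ≤ α) {γ : ℂ} (hγ : 0 ≤ γ.im) :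
    taylorCoeff (fun z => c * z ^ m * Complex.exp (-(α : ℂ) * z ^ 2 + γ * z) *
      ∏ j ∈ s, (1 + w j * z)) ∈ closure upperRootsCoeffs := by
  let p (n : ℕ) : ℂ[X] := C c * X ^ m * ((1 + C (-((α / n : ℝ) : ℂ)) * X ^ 2) ^ n *
    (1 + C (γ / n) * X) ^ n) * ∏ j ∈ s, (1 + C (w j) * X)
  have hX : UpperRoots (X : ℂ[X]) := by
    intro z hz h
    rw [eval_X] at h
    simp [h] at hz
  have hp (n : ℕ) : UpperRoots (p n) := by
    refine (((UpperRoots.const c).mul (hX.pow m)).mul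
      (((upperRoots_one_add_C_mul_X_sq (by positivity)).pow n).mul
      ((UpperRoots.one_add_C_mul_X ?_).pow n))).mul
      (UpperRoots.prod s _ fun j hj => UpperRoots.one_add_C_mul_X (hw j hj))
    rw [Complex.div_natCast_im]
    positivity
  have hev (n : ℕ) (z : ℂ) : (p n).eval z = c * z ^ m *
      ((1 + (-(α : ℂ) * z ^ 2) / n) ^ n * (1 + (γ * z) / n) ^ n) * ∏ j ∈ s, (1 + w j * z) := by
    simp only [p, eval_mul, eval_C, eval_pow, eval_X, eval_add, eval_one, eval_prod]
    push_cast
    ring_nf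
  refine mem_closure_of_tendsto (tendsto_taylorCoeff (l := atTop)
    (G := fun n z => (p n).eval z)
    (M := ‖c‖ * (Real.exp α * Real.exp ‖γ‖) * ∏ j ∈ s, (1 + ‖w j‖))
    (fun n => (p n).differentiable) (by fun_prop) (fun n z hz => ?_) fun z _ => ?_)
    (Eventually.of_forall fun n => ⟨p n, hp n, fun k => taylorCoeff_eval (p n) k⟩)
  · rw [hev]
    simp only [norm_mul, norm_prod, norm_pow (z : ℂ), hz, one_pow, mul_one]
    gcongr with j hj
    · have h1 : ‖-(α : ℂ) * z ^ 2‖ = α := by simp [hz, abs_of_nonneg hα]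
      exact (norm_one_add_div_pow_le _ n).trans_eq (by rw [h1])
    · simpa [hz] using norm_one_add_div_pow_le (γ * z) n
    · refine (norm_add_le _ _).trans ?_
      simp [hz]
  · simp_rw [hev, Complex.exp_add]
    exact (((Complex.tendsto_one_add_div_pow_exp _).mul
      (Complex.tendsto_one_add_div_pow_exp _)).const_mul _).mul_const _

theorem taylorCoeff_mem_closure_of_mem_PolyaObrechkoff {F : ℂ → ℂ} (hF : F ∈ PolyaObrechkoff) :
    taylorCoeff F ∈ closure upperRootsCoeffs := by
  obtain ⟨hd, c, m, α, β, ι, hι, a, hα, ha, hs2, hs1, hle, hP⟩ := hF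
  choose P hP hFP using hP
  rw [← closure_closure]
  have him (j : ι) : 0 ≤ (-(a j)⁻¹).im := by
    have : 0 ≤ (a j).im := (ha j).1
    rw [Complex.neg_im, Complex.inv_im, neg_div, neg_neg]
    exact div_nonneg this (Complex.normSq_nonneg _)
  have hG (s : Finset ι) (z : ℂ) : c * z ^ m * Complex.exp (-(α : ℂ) * z ^ 2 + β * z) *
      ∏ j ∈ s, ((1 - z / a j) * Complex.exp (z / a j)) =
      c * z ^ m * Complex.exp (-(α : ℂ) * z ^ 2 + (β + ∑ j ∈ s, (a j)⁻¹) * z) *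
        ∏ j ∈ s, (1 + -(a j)⁻¹ * z) := by
    rw [Finset.prod_mul_distrib, ← Complex.exp_sum, add_mul, ← add_assoc, Complex.exp_add _
      ((∑ j ∈ s, (a j)⁻¹) * z), Finset.sum_mul]
    have h1 : ∏ j ∈ s, (1 - z / a j) = ∏ j ∈ s, (1 + -(a j)⁻¹ * z) :=
      Finset.prod_congr rfl fun j _ => by ring
    have h2 : ∑ j ∈ s, z / a j = ∑ j ∈ s, (a j)⁻¹ * z :=
      Finset.sum_congr rfl fun j _ => by ring
    rw [h1, h2]
    ring
  -- Countability of `ι` makes this filter countably generated, as dominated convergence requires.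
  refine mem_closure_of_tendsto (tendsto_taylorCoeff (l := (atTop : Filter (Finset ι)))
    (G := fun s z => c * z ^ m * Complex.exp (-(α : ℂ) * z ^ 2 + β * z) *
      ∏ j ∈ s, ((1 - z / a j) * Complex.exp (z / a j)))
    (M := ‖c‖ * Real.exp (α + ‖β‖) * Real.exp (∑' j, (‖a j‖ ^ 2)⁻¹ / 2))
    (fun s => by fun_prop) hd (fun s z hz => ?_) fun z _ => ?_)
    (Eventually.of_forall fun s => ?_)
  · simp only [norm_mul, norm_prod, norm_pow (z : ℂ), hz, one_pow, mul_one]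
    gcongr
    · refine (Complex.norm_exp_le_exp_norm _).trans (Real.exp_le_exp.mpr ?_)
      refine (norm_add_le _ _).trans ?_
      simp [hz, abs_of_nonneg hα]
    · calc ∏ j ∈ s, ‖1 - z / a j‖ * ‖Complex.exp (z / a j)‖
          ≤ ∏ j ∈ s, Real.exp ((‖a j‖ ^ 2)⁻¹ / 2) := by
            refine Finset.prod_le_prod (fun _ _ => by positivity) fun j _ => ?_
            have := norm_one_add_mul_exp_neg_le (-(z / a j))
            rw [neg_neg, norm_mul, ← sub_eq_add_neg] at this
            simpa [hz] using this
        _ ≤ Real.exp (∑' j, (‖a j‖ ^ 2)⁻¹ / 2) := by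
            rw [← Real.exp_sum]
            exact Real.exp_le_exp.mpr
              ((hs2.div_const 2).sum_le_tsum s fun j _ => by positivity)
  · rw [hFP z]
    exact Tendsto.const_mul _ (hP z)
  · simp_rw [hG]
    refine taylorCoeff_finite_product_mem_closure s _ (fun j _ => him j) c m hα ?_
    -- The factors $e^{z/a_j}$ moved into the exponent lower $\operatorname{Im}\beta$ by a partial
    -- sum of $\sum\operatorname{Im}(-1/a_j)\le\operatorname{Im}\beta$.
    have h1 := hs1.sum_le_tsum s fun j _ => him j
    simp only [Complex.add_im, Complex.im_sum]
    simp only [Complex.neg_im, Finset.sum_neg_distrib] at h1 hle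
    linarith

/-! ### Sorted factorizations and power sums -/

theorem differentiable_of_hasSum {F : ℂ → ℂ} {a : ℕ → ℂ}
    (h : ∀ z, HasSum (fun k => a k * z ^ k) (F z)) : Differentiable ℂ F := by
  intro z
  set R : ℝ := ‖z‖ + 1
  have hR : 0 ≤ R := by positivity
  have h1 : DifferentiableOn ℂ (fun z => ∑' k, a k * z ^ k) (Metric.ball 0 R) := by
    refine Complex.differentiableOn_tsum_of_summable_norm (h (R : ℂ)).summable.norm
      (fun k => by fun_prop) Metric.isOpen_ball fun k w hw => ?_
    rw [mem_ball_zero_iff] at hw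
    simp only [norm_mul, norm_pow, Complex.norm_real, Real.norm_eq_abs, abs_of_nonneg hR]
    gcongr
  have h2 : F = fun z => ∑' k, a k * z ^ k := funext fun z => (h z).tsum_eq.symm
  rw [h2]
  exact h1.differentiableAt (Metric.isOpen_ball.mem_nhds (by simp [R]))

theorem prod_range_getD {M : Type*} [CommMonoid M] (f : ℂ → M) (l : List ℂ) :
    ∏ j ∈ Finset.range l.length, f (l.getD j 0) = (l.map f).prod := by
  induction l with
  | nil => simp
  | cons a l ih =>
    rw [List.length_cons, Finset.prod_range_succ']
    simp only [List.getD_cons_succ, List.getD_cons_zero, List.map_cons, List.prod_cons]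
    rw [ih, mul_comm]

open Polynomial in
theorem eq_prod_one_add_C_mul_X {p : ℂ[X]} (h0 : p.coeff 0 = 1) :
    p = (p.roots.map fun r => 1 + C (-r⁻¹) * X).prod := by
  have hp : p ≠ 0 := by rintro rfl; simp at h0
  have key : ∀ s : Multiset ℂ, (∀ r ∈ s, r ≠ 0) → (s.map fun r => X - C r).prod =
      C (s.map fun r => -r).prod * (s.map fun r => 1 + C (-r⁻¹) * X).prod := by
    intro s
    induction s using Multiset.induction with
    | empty => simp
    | cons a s ih =>
      intro hs
      have h1 := ih fun r hr => hs r (Multiset.mem_cons_of_mem hr)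
      have ha : a ≠ 0 := hs a (Multiset.mem_cons_self a s)
      have h2 : X - C a = C (-a) * (1 + C (-a⁻¹) * X) := by
        rw [mul_add, ← mul_assoc, ← C_mul, neg_mul_neg, mul_inv_cancel₀ ha, C_1]
        simp
        ring
      simp only [Multiset.map_cons, Multiset.prod_cons]
      rw [h1, h2, C_mul]
      ring
  have hr0 : ∀ r ∈ p.roots, r ≠ 0 := by
    rintro r hr rfl
    have := isRoot_of_mem_roots hr
    rw [IsRoot, ← coeff_zero_eq_eval_zero, h0] at this
    exact one_ne_zero this
  have h1 := (IsAlgClosed.splits p).eq_prod_roots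
  rw [key _ hr0, ← mul_assoc, ← C_mul] at h1
  have h2 := h0
  rw [h1, coeff_C_mul, coeff_zero_eq_eval_zero, eval_multiset_prod] at h2
  have h3 : p.leadingCoeff * (p.roots.map fun r => -r).prod = 1 := by
    simpa using h2
  rwa [h3, C_1, one_mul] at h1

open Polynomial in
-- The $w_j$ are the numbers $-1/r$, padded with zeros. Their decreasing order later turns a bound
-- on $\sum|w_j|^2$ into a decay rate uniform over the polynomials.
theorem UpperRoots.exists_sorted_factorization {p : ℂ[X]} (hp : UpperRoots p)
    (h0 : p.coeff 0 = 1) :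
    ∃ (N : ℕ) (w : ℕ → ℂ), (∀ j, 0 ≤ (w j).im) ∧ (∀ j, N ≤ j → w j = 0) ∧
      Antitone (fun j => ‖w j‖) ∧ p = ∏ j ∈ Finset.range N, (1 + C (w j) * X) := by
  classical
  have hp0 : p ≠ 0 := by rintro rfl; simp at h0
  let r : ℂ → ℂ → Prop := fun x y => ‖y‖ ≤ ‖x‖
  have : Std.Total r := ⟨fun x y => le_total _ _⟩
  have : IsTrans ℂ r := ⟨fun x y z h1 h2 => le_trans h2 h1⟩
  set l := (p.roots.map fun r => -r⁻¹).toList.insertionSort r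
  have hl : (l : Multiset ℂ) = p.roots.map fun r => -r⁻¹ := by
    rw [← Multiset.coe_toList (p.roots.map fun r => -r⁻¹), Multiset.coe_eq_coe]
    exact List.perm_insertionSort r _
  have hsort : l.Pairwise r := List.pairwise_insertionSort r _
  have hzero (j : ℕ) (hj : l.length ≤ j) : l.getD j 0 = 0 := List.getD_eq_default _ _ hj
  refine ⟨l.length, fun j => l.getD j 0, fun j => ?_, hzero, fun i j hij => ?_, ?_⟩
  · beta_reduce
    rcases lt_or_ge j l.length with hj | hj
    · have hmem : l.getD j 0 ∈ (l : Multiset ℂ) := by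
        rw [List.getD_eq_getElem _ _ hj]
        exact List.getElem_mem hj
      rw [hl, Multiset.mem_map] at hmem
      obtain ⟨r, hr, hreq⟩ := hmem
      rw [← hreq, Complex.neg_im, Complex.inv_im, neg_div, neg_neg]
      refine div_nonneg ?_ (Complex.normSq_nonneg _)
      by_contra! hneg
      exact hp0 (hp r hneg (isRoot_of_mem_roots hr))
    · rw [hzero j hj, Complex.zero_im]
  · beta_reduce
    rcases lt_or_ge j l.length with hj | hj
    · rcases hij.eq_or_lt with rfl | hlt
      · exact le_rfl
      · rw [List.getD_eq_getElem _ _ hj, List.getD_eq_getElem _ _ (hlt.trans hj)]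
        exact List.pairwise_iff_getElem.mp hsort i j _ _ hlt
    · rw [hzero j hj, norm_zero]
      positivity
  · rw [prod_range_getD (fun w => 1 + C w * X) l, ← Multiset.prod_coe, ← Multiset.map_coe, hl,
      Multiset.map_map]
    exact eq_prod_one_add_C_mul_X h0

open Polynomial in
theorem coeff_prod_one_add_C_mul_X (w : ℕ → ℂ) (N : ℕ) :
    (∏ j ∈ Finset.range N, (1 + C (w j) * X)).coeff 0 = 1 ∧
    (∏ j ∈ Finset.range N, (1 + C (w j) * X)).coeff 1 = ∑ j ∈ Finset.range N, w j ∧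
    (∏ j ∈ Finset.range N, (1 + C (w j) * X)).coeff 1 ^ 2 -
      2 * (∏ j ∈ Finset.range N, (1 + C (w j) * X)).coeff 2 = ∑ j ∈ Finset.range N, w j ^ 2 := by
  induction N with
  | zero => simp [coeff_one]
  | succ N ih =>
    obtain ⟨h0, h1, h2⟩ := ih
    simp only [Finset.prod_range_succ, Finset.sum_range_succ]
    rw [← h1, ← h2]
    set q := ∏ j ∈ Finset.range N, (1 + C (w j) * X)
    have hs (k : ℕ) : (q * (1 + C (w N) * X)).coeff (k + 1) = q.coeff (k + 1) + q.coeff k * w N := by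
      rw [mul_add, mul_one, coeff_add, ← mul_assoc, coeff_mul_X, coeff_mul_C]
    have hs0 : (q * (1 + C (w N) * X)).coeff 0 = q.coeff 0 := by
      rw [mul_add, mul_one, coeff_add, ← mul_assoc, coeff_mul_X_zero, add_zero]
    refine ⟨hs0.trans h0, ?_, ?_⟩
    · rw [hs 0, h0, one_mul]
    · rw [hs 0, hs 1, h0]
      ring

/-! ### Primary factors and their infinite products -/

/-- The primary factor `(1 + u) exp (-u + u ^ 2 / 2)`. -/
noncomputable def primaryFactor (u : ℂ) : ℂ := (1 + u) * Complex.exp (-u + u ^ 2 / 2)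

theorem exists_norm_primaryFactor_sub_one_le (R : ℝ) :
    ∃ K : ℝ, 0 ≤ K ∧ ∀ u : ℂ, ‖u‖ ≤ R → ‖primaryFactor u - 1‖ ≤ K * ‖u‖ ^ 3 := by
  rcases lt_or_ge R 0 with hR | hR
  · exact ⟨0, le_rfl, fun u hu => absurd (hu.trans_lt hR) (norm_nonneg u).not_gt⟩
  refine ⟨(1 / 2 + 3 / 8 * R + 1 / 8 * R ^ 2) +
    (1 + R) * ((1 + R / 2) ^ 3 * Real.exp (R * (1 + R / 2))), by positivity, fun u hu => ?_⟩
  set v := -u + u ^ 2 / 2 with hv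
  have hvn : ‖v‖ ≤ ‖u‖ * (1 + R / 2) := by
    have h1 : v = u * (-1 + u / 2) := by rw [hv]; ring
    have h2 : ‖-1 + u / 2‖ ≤ 1 + R / 2 := by
      refine (norm_add_le _ _).trans ?_
      simp only [norm_neg, norm_one, norm_div, Complex.norm_ofNat]
      linarith
    rw [h1, norm_mul]
    gcongr
  have hexp := Complex.norm_exp_sub_sum_le_norm_mul_exp v 3
  simp only [Finset.sum_range_succ, Finset.sum_range_zero] at hexp
  norm_num [Nat.factorial] at hexp
  have hsplit : primaryFactor u - 1 = u ^ 3 * (1 / 2 - 3 / 8 * u + 1 / 8 * u ^ 2) +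
      (1 + u) * (Complex.exp v - (1 + v + v ^ 2 / 2)) := by
    rw [primaryFactor, ← hv]
    -- The exponent is the Taylor polynomial of $-\log(1+u)$ of degree 2, so the terms in $u$ and
    -- $u^2$ cancel.
    have : (1 + u) * (1 + v + v ^ 2 / 2) = 1 + u ^ 3 * (1 / 2 - 3 / 8 * u + 1 / 8 * u ^ 2) := by
      rw [hv]; ring
    linear_combination this
  have hq : ‖1 / 2 - 3 / 8 * u + 1 / 8 * u ^ 2‖ ≤ 1 / 2 + 3 / 8 * R + 1 / 8 * R ^ 2 := by
    refine (norm_add_le _ _).trans (add_le_add ((norm_sub_le _ _).trans (add_le_add ?_ ?_)) ?_)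
    · norm_num
    · rw [norm_mul]; norm_num; linarith
    · rw [norm_mul, norm_pow]; norm_num; gcongr
  have h1u : ‖1 + u‖ ≤ 1 + R := (norm_add_le _ _).trans (by simpa using hu)
  rw [hsplit]
  calc _ ≤ ‖u‖ ^ 3 * (1 / 2 + 3 / 8 * R + 1 / 8 * R ^ 2) +
        (1 + R) * ((‖u‖ * (1 + R / 2)) ^ 3 * Real.exp (R * (1 + R / 2))) := by
        refine (norm_add_le _ _).trans (add_le_add ?_ ?_)
        · rw [norm_mul, norm_pow]; gcongr
        · rw [norm_mul]
          gcongr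
          refine hexp.trans ?_
          gcongr
          exact hvn.trans (by gcongr)
    _ = _ := by ring

theorem primaryFactor_mul_exp (u : ℂ) :
    primaryFactor u * Complex.exp (u - u ^ 2 / 2) = 1 + u := by
  rw [primaryFactor, mul_assoc, ← Complex.exp_add]
  simp

theorem summable_sqrt_div_pow_three (C : ℝ) : Summable fun j : ℕ => √(C / (j + 1)) ^ 3 := by
  have h1 : Summable fun j : ℕ => 1 / |(j : ℝ) + 1| ^ (3 / 2 : ℝ) :=
    (Real.summable_one_div_nat_add_rpow 1 (3 / 2)).mpr (by norm_num)
  refine (h1.mul_left (√C ^ 3)).congr fun j => ?_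
  have hj : (0 : ℝ) ≤ (j : ℝ) + 1 := by positivity
  have h2 : |(j : ℝ) + 1| ^ (3 / 2 : ℝ) = √((j : ℝ) + 1) ^ 3 := by
    rw [abs_of_nonneg hj, Real.sqrt_eq_rpow, ← Real.rpow_natCast, ← Real.rpow_mul hj]
    norm_num
  rw [Real.sqrt_div' _ hj, div_pow, h2]
  ring

/-- The decay $\sqrt{C/(j+1)}$ has summable cubes but, in general, not summable squares. Hence the
second-order convergence factor, with $\sum w_j$ and $\sum w_j^2$ tracked separately. -/
theorem exists_summable_bound_primaryFactor (C : ℝ) (z : ℂ) :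
    ∃ u : ℕ → ℝ, Summable u ∧ ∀ (j : ℕ) (x : ℂ), ‖x‖ ≤ √(C / (j + 1)) →
      ‖primaryFactor (x * z) - 1‖ ≤ u j := by
  obtain ⟨K, hK, hK'⟩ := exists_norm_primaryFactor_sub_one_le (√C * ‖z‖)
  refine ⟨fun j => K * ‖z‖ ^ 3 * √(C / (j + 1)) ^ 3,
    (summable_sqrt_div_pow_three C).mul_left _, fun j x hx => ?_⟩
  have h1 : ‖x‖ ≤ √C := by
    refine hx.trans ?_
    have hj : (0 : ℝ) ≤ (j : ℝ) + 1 := by positivity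
    rw [Real.sqrt_div' _ hj]
    exact div_le_self (Real.sqrt_nonneg _) (Real.one_le_sqrt.mpr (by linarith [j.cast_nonneg (α := ℝ)]))
  calc _ ≤ K * ‖x * z‖ ^ 3 := hK' _ (by
        rw [norm_mul]
        exact mul_le_mul_of_nonneg_right h1 (norm_nonneg z))
    _ = K * ‖z‖ ^ 3 * ‖x‖ ^ 3 := by rw [norm_mul]; ring
    _ ≤ K * ‖z‖ ^ 3 * √(C / (j + 1)) ^ 3 := by gcongr

theorem multipliable_primaryFactor {x : ℕ → ℂ} {C : ℝ} (hx : ∀ j, ‖x j‖ ≤ √(C / (j + 1)))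
    (z : ℂ) : Multipliable fun j => primaryFactor (x j * z) := by
  obtain ⟨u, hu, hbound⟩ := exists_summable_bound_primaryFactor C z
  have := multipliable_one_add_of_summable (f := fun j => primaryFactor (x j * z) - 1)
    (hu.of_nonneg_of_le (fun _ => norm_nonneg _) fun j => hbound j _ (hx j))
  simpa using this

theorem hasProd_one_add_mul {x : ℕ → ℂ} {C : ℝ} (hx : ∀ j, ‖x j‖ ≤ √(C / (j + 1))) {b s : ℂ}
    (hb : HasSum x b) (hs : HasSum (fun j => x j ^ 2) s) (z : ℂ) :
    HasProd (fun j => 1 + x j * z)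
      ((∏' j, primaryFactor (x j * z)) * Complex.exp (b * z - s * z ^ 2 / 2)) := by
  have h1 := (multipliable_primaryFactor hx z).hasProd
  have h2 : HasSum (fun j => x j * z - (x j * z) ^ 2 / 2) (b * z - s * z ^ 2 / 2) := by
    rw [mul_div_assoc]
    have e : (fun j => x j * z - (x j * z) ^ 2 / 2) =
        fun j => x j * z - x j ^ 2 * (z ^ 2 / 2) := funext fun j => by ring
    rw [e]
    exact (hb.mul_right z).sub (hs.mul_right (z ^ 2 / 2))
  convert h1.mul h2.cexp using 1
  ext j
  exact (primaryFactor_mul_exp _).symm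

theorem hasProd_one_add_mul_exp_neg {x : ℕ → ℂ} {C : ℝ} (hx : ∀ j, ‖x j‖ ≤ √(C / (j + 1)))
    {s : ℂ} (hs : HasSum (fun j => x j ^ 2) s) (z : ℂ) :
    HasProd (fun j => (1 + x j * z) * Complex.exp (-(x j * z)))
      ((∏' j, primaryFactor (x j * z)) * Complex.exp (-(s * z ^ 2 / 2))) := by
  have h1 := (multipliable_primaryFactor hx z).hasProd
  have h2 : HasSum (fun j => -((x j * z) ^ 2 / 2)) (-(s * z ^ 2 / 2)) := by
    rw [mul_div_assoc]
    have e : (fun j => -((x j * z) ^ 2 / 2)) = fun j => -(x j ^ 2 * (z ^ 2 / 2)) :=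
      funext fun j => by ring
    rw [e]
    exact (hs.mul_right (z ^ 2 / 2)).neg
  convert h1.mul h2.cexp using 1
  ext j
  rw [Function.comp_apply, ← primaryFactor_mul_exp, mul_assoc, ← Complex.exp_add]
  ring_nf

theorem tendsto_tprod_primaryFactor {w : ℕ → ℕ → ℂ} {v : ℕ → ℂ} {C : ℝ}
    (hw : ∀ i j, ‖w i j‖ ≤ √(C / (j + 1)))
    (hv : ∀ j, Tendsto (fun i => w i j) atTop (𝓝 (v j))) (z : ℂ) :
    Tendsto (fun i => ∏' j, primaryFactor (w i j * z)) atTop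
      (𝓝 (∏' j, primaryFactor (v j * z))) := by
  obtain ⟨u, hu, hbound⟩ := exists_summable_bound_primaryFactor C z
  have hcont : Continuous primaryFactor := by unfold primaryFactor; fun_prop
  have := tendsto_tprod_one_add_of_dominated_convergence (𝓕 := atTop)
    (f := fun i j => primaryFactor (w i j * z) - 1) (g := fun j => primaryFactor (v j * z) - 1) hu
    (fun j => ((hcont.tendsto _).comp ((hv j).mul_const z)).sub_const 1)
    (Eventually.of_forall fun i j => hbound j _ (hw i j))
  simpa using this

/-! ### Passage to the limit in the products -/

/-- No negative mass escapes from `L (w ^ 2)` in the limit, as the tails of `∑ ‖w‖ * Im w` are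
uniformly small. -/
theorem map_sub_tsum_sq_nonneg (L : ℂ →L[ℝ] ℝ) (hL : ∀ u : ℂ, 0 ≤ u.im → -(2 * ‖u‖ * u.im) ≤ L (u ^ 2))
    {w : ℕ → ℕ → ℂ} {v b s : ℕ → ℂ} {β σ τ : ℂ} {C : ℝ} (him : ∀ i j, 0 ≤ (w i j).im)
    (hw : ∀ i j, ‖w i j‖ ≤ √(C / (j + 1))) (hv : ∀ j, Tendsto (fun i => w i j) atTop (𝓝 (v j)))
    (hb : ∀ i, HasSum (w i) (b i)) (hs : ∀ i, HasSum (fun j => w i j ^ 2) (s i))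
    (hβ : Tendsto b atTop (𝓝 β)) (hσ : Tendsto s atTop (𝓝 σ))
    (hτ : HasSum (fun j => v j ^ 2) τ) : 0 ≤ L (σ - τ) := by
  have htail (i n : ℕ) : -(2 * √(C / (n + 1)) * (b i).im) ≤
      L (s i - ∑ j ∈ Finset.range n, w i j ^ 2) := by
    have h1 : HasSum (fun j => L (w i (j + n) ^ 2)) (L (s i - ∑ j ∈ Finset.range n, w i j ^ 2)) :=
      ((hasSum_nat_add_iff' n).mpr (hs i)).mapL L
    have him' : HasSum (fun j => (w i j).im) (b i).im := Complex.hasSum_im (hb i)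
    have h2 := (((hasSum_nat_add_iff' n).mpr him').mul_left (2 * √(C / (n + 1)))).neg
    have h3 := hasSum_le (fun j => ?_) h2 h1
    · refine le_trans ?_ h3
      have h4 : 0 ≤ ∑ j ∈ Finset.range n, (w i j).im := Finset.sum_nonneg fun j _ => him i j
      have h5 : 0 ≤ √(C / (n + 1)) := Real.sqrt_nonneg _
      nlinarith [mul_nonneg h5 h4]
    · refine le_trans (neg_le_neg ?_) (hL _ (him i (j + n)))
      have h4 : ‖w i (j + n)‖ ≤ √(C / (n + 1)) := by
        -- For negative $C$ the quotient increases with $j$, but its `√` is 0.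
        rcases lt_or_ge C 0 with hC | hC
        · refine (hw i (j + n)).trans ?_
          rw [Real.sqrt_eq_zero_of_nonpos (div_nonpos_of_nonpos_of_nonneg hC.le (by positivity))]
          positivity
        · refine (hw i (j + n)).trans (Real.sqrt_le_sqrt ?_)
          push_cast
          gcongr
          linarith [j.cast_nonneg (α := ℝ)]
      have := him i (j + n)
      gcongr
  have hlim (n : ℕ) : -(2 * √(C / (n + 1)) * β.im) ≤
      L (σ - ∑ j ∈ Finset.range n, v j ^ 2) := by
    refine le_of_tendsto_of_tendsto' (b := atTop) ?_ ?_ (fun i => htail i n)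
    · exact (((Complex.continuous_im.tendsto _).comp hβ).const_mul _).neg
    · exact (L.continuous.tendsto _).comp
        (hσ.sub (tendsto_finsetSum _ fun j _ => (hv j).pow 2))
  have h1 : Tendsto (fun n : ℕ => -(2 * √(C / (n + 1)) * β.im)) atTop (𝓝 0) := by
    have h2 : Tendsto (fun n : ℕ => C / ((n : ℝ) + 1)) atTop (𝓝 0) :=
      tendsto_const_nhds.div_atTop (tendsto_atTop_add_const_right _ _ tendsto_natCast_atTop_atTop)
    have h3 := (Real.continuous_sqrt.tendsto _).comp h2
    rw [Real.sqrt_zero] at h3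
    simpa using ((h3.const_mul 2).mul_const β.im).neg
  exact le_of_tendsto_of_tendsto' h1
    ((L.continuous.tendsto _).comp (hτ.tendsto_sum_nat.const_sub σ)) hlim

theorem two_mul_norm_mul_im_bounds (u : ℂ) (hu : 0 ≤ u.im) :
    -(2 * ‖u‖ * u.im) ≤ (u ^ 2).re ∧ |(u ^ 2).im| ≤ 2 * ‖u‖ * u.im := by
  have h1 : (u ^ 2).re = u.re ^ 2 - u.im ^ 2 := by rw [sq, Complex.mul_re]; ring
  have h2 : (u ^ 2).im = 2 * u.re * u.im := by rw [sq, Complex.mul_im]; ring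
  have h3 : u.im ≤ ‖u‖ := (le_abs_self _).trans (Complex.abs_im_le_norm u)
  have h4 : |u.re| ≤ ‖u‖ := Complex.abs_re_le_norm u
  constructor
  · rw [h1]
    nlinarith [sq_nonneg u.re, mul_le_mul_of_nonneg_right h3 hu, mul_nonneg (norm_nonneg u) hu]
  · rw [h2, abs_mul, abs_mul, abs_of_nonneg hu, abs_two]
    gcongr

/-- Taking $L=\operatorname{Re},\operatorname{Im},-\operatorname{Im}$ shows that the lost mass is
real and nonnegative. It is the source of the Gaussian factor. -/
theorem exists_nonneg_eq_sub_tsum_sq {w : ℕ → ℕ → ℂ} {v b s : ℕ → ℂ} {β σ τ : ℂ} {C : ℝ}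
    (him : ∀ i j, 0 ≤ (w i j).im)
    (hw : ∀ i j, ‖w i j‖ ≤ √(C / (j + 1))) (hv : ∀ j, Tendsto (fun i => w i j) atTop (𝓝 (v j)))
    (hb : ∀ i, HasSum (w i) (b i)) (hs : ∀ i, HasSum (fun j => w i j ^ 2) (s i))
    (hβ : Tendsto b atTop (𝓝 β)) (hσ : Tendsto s atTop (𝓝 σ))
    (hτ : HasSum (fun j => v j ^ 2) τ) : ∃ α : ℝ, 0 ≤ α ∧ σ - τ = 2 * α := by
  have h1 := map_sub_tsum_sq_nonneg Complex.reCLM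
    (fun u hu => (two_mul_norm_mul_im_bounds u hu).1) him hw hv hb hs hβ hσ hτ
  have h2 := map_sub_tsum_sq_nonneg Complex.imCLM
    (fun u hu => neg_le_of_abs_le (two_mul_norm_mul_im_bounds u hu).2) him hw hv hb hs hβ hσ hτ
  have h3 := map_sub_tsum_sq_nonneg (-Complex.imCLM)
    (fun u hu => neg_le_neg (le_of_abs_le (two_mul_norm_mul_im_bounds u hu).2))
    him hw hv hb hs hβ hσ hτ
  simp only [Complex.reCLM_apply, Complex.imCLM_apply, neg_apply] at h1 h2 h3
  refine ⟨(σ - τ).re / 2, by positivity, ?_⟩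
  apply Complex.ext
  · simp; ring
  · simp only [Complex.mul_im, Complex.ofReal_im, Complex.re_ofNat, Complex.im_ofNat]
    linarith

/-- A limit of the finite products `∏ (1 + w i j * z)` with `w i j` in the closed upper half
plane lies in the Pólya-Obrechkoff class. -/
theorem mem_PolyaObrechkoff_of_tendsto_prod {w : ℕ → ℕ → ℂ} {v b s : ℕ → ℂ} {β σ : ℂ} {C : ℝ}
    (him : ∀ i j, 0 ≤ (w i j).im) (hw : ∀ i j, ‖w i j‖ ≤ √(C / (j + 1)))
    (hC : ∀ i n, ∑ j ∈ Finset.range n, ‖w i j‖ ^ 2 ≤ C)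
    (hv : ∀ j, Tendsto (fun i => w i j) atTop (𝓝 (v j)))
    (hb : ∀ i, HasSum (w i) (b i)) (hs : ∀ i, HasSum (fun j => w i j ^ 2) (s i))
    (hβ : Tendsto b atTop (𝓝 β)) (hσ : Tendsto s atTop (𝓝 σ)) {F : ℂ → ℂ}
    (hF : ∀ z, Tendsto (fun i => ∏' j, (1 + w i j * z)) atTop (𝓝 (F z)))
    (hd : Differentiable ℂ F) (c : ℂ) (m : ℕ) :
    (fun z => c * z ^ m * F z) ∈ PolyaObrechkoff := by
  have hvim (j : ℕ) : 0 ≤ (v j).im :=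
    ge_of_tendsto' ((Complex.continuous_im.tendsto _).comp (hv j)) fun i => him i j
  have hvn (j : ℕ) : ‖v j‖ ≤ √(C / (j + 1)) := le_of_tendsto' (hv j).norm fun i => hw i j
  have hv2 : Summable fun j => ‖v j‖ ^ 2 :=
    summable_of_sum_range_le (c := C) (fun _ => by positivity) fun n =>
      le_of_tendsto' (tendsto_finsetSum _ fun j _ => (hv j).norm.pow 2) fun i => hC i n
  have hvsum (n : ℕ) : ∑ j ∈ Finset.range n, (v j).im ≤ β.im :=
    le_of_tendsto_of_tendsto'
      (tendsto_finsetSum _ fun j _ => (Complex.continuous_im.tendsto _).comp (hv j))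
      ((Complex.continuous_im.tendsto _).comp hβ)
      fun i => sum_le_hasSum _ (fun j _ => him i j) (Complex.hasSum_im (hb i))
  have hv1 : Summable fun j => (v j).im := summable_of_sum_range_le hvim hvsum
  have hvle : ∑' j, (v j).im ≤ β.im := Real.tsum_le_of_sum_range_le hvim hvsum
  have hτ : HasSum (fun j => v j ^ 2) (∑' j, v j ^ 2) :=
    (Summable.of_norm (by simpa only [norm_pow] using hv2)).hasSum
  obtain ⟨α, hα, hατ⟩ := exists_nonneg_eq_sub_tsum_sq him hw hv hb hs hβ hσ hτ
  have hFeq (z : ℂ) : F z =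
      (∏' j, primaryFactor (v j * z)) * Complex.exp (β * z - σ * z ^ 2 / 2) := by
    refine tendsto_nhds_unique (hF z) ?_
    simp_rw [fun i => (hasProd_one_add_mul (hw i) (hb i) (hs i) z).tprod_eq]
    refine (tendsto_tprod_primaryFactor hw hv z).mul ?_
    exact (Complex.continuous_exp.tendsto _).comp
      ((hβ.mul_const z).sub ((hσ.mul_const (z ^ 2)).div_const 2))
  -- Indices with $v_j=0$ contribute the factor 1 and correspond to zeros escaped to infinity.
  refine ⟨by fun_prop, c, m, α, β, ({j | v j ≠ 0} : Set ℕ), inferInstance, fun j => -(v j)⁻¹, hα,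
    fun j => ⟨?_, ?_⟩, ?_, ?_, ?_, fun z => ?_⟩
  · change 0 ≤ (-(v j)⁻¹).im
    rw [Complex.neg_im, Complex.inv_im, neg_div, neg_neg]
    exact div_nonneg (hvim j) (Complex.normSq_nonneg _)
  · have : v j ≠ 0 := j.2
    simpa using this
  · exact (hv2.subtype {j | v j ≠ 0}).congr fun j => by simp
  · exact (hv1.subtype {j | v j ≠ 0}).congr fun j => by simp [inv_neg]
  · refine le_trans (le_of_eq ?_) hvle
    have := tsum_subtype_eq_of_support_subset (f := fun j => (v j).im) (s := {j | v j ≠ 0})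
      (by intro j hj h0; simp [h0] at hj)
    rw [← this]
    exact tsum_congr fun j => by simp [inv_neg]
  · refine ⟨(∏' j, primaryFactor (v j * z)) * Complex.exp (-((∑' j, v j ^ 2) * z ^ 2 / 2)), ?_, ?_⟩
    · have h1 := hasProd_one_add_mul_exp_neg hvn hτ z
      rw [← hasProd_subtype_iff_of_mulSupport_subset (s := {j | v j ≠ 0})] at h1
      · convert! h1 using 2 with j
        simp [div_eq_mul_inv, inv_neg, mul_comm]
      · intro j hj h0
        simp [h0] at hj
    · beta_reduce
      rw [hFeq z]
      have hσ' : σ = 2 * α + ∑' j, v j ^ 2 := by linear_combination hατ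
      have he : Complex.exp (β * z - σ * z ^ 2 / 2) =
          Complex.exp (-(α : ℂ) * z ^ 2 + β * z) *
            Complex.exp (-((∑' j, v j ^ 2) * z ^ 2 / 2)) := by
        rw [← Complex.exp_add, hσ']
        ring_nf
      rw [he]
      ring

/-! ### Uniform bounds and compactness -/

theorem norm_prod_one_add_mul_le {w : ℕ → ℂ} {N : ℕ} {D : ℝ}
    (hD : ∑ j ∈ Finset.range N, ‖w j‖ ^ 2 ≤ D) (z : ℂ) :
    ‖∏ j ∈ Finset.range N, (1 + w j * z)‖ ≤
      Real.exp (‖∑ j ∈ Finset.range N, w j‖ * ‖z‖ + D * ‖z‖ ^ 2 / 2) := by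
  have h1 : ∏ j ∈ Finset.range N, (1 + w j * z) =
      Complex.exp ((∑ j ∈ Finset.range N, w j) * z) *
        ∏ j ∈ Finset.range N, ((1 + w j * z) * Complex.exp (-(w j * z))) := by
    rw [Finset.sum_mul, Complex.exp_sum, ← Finset.prod_mul_distrib]
    refine Finset.prod_congr rfl fun j _ => ?_
    rw [mul_left_comm, ← Complex.exp_add]
    simp
  rw [h1, norm_mul, norm_prod, Real.exp_add]
  gcongr
  · exact (Complex.norm_exp_le_exp_norm _).trans_eq (by rw [norm_mul])
  · calc _ ≤ ∏ j ∈ Finset.range N, Real.exp (‖w j * z‖ ^ 2 / 2) :=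
        Finset.prod_le_prod (fun _ _ => norm_nonneg _) fun j _ => norm_one_add_mul_exp_neg_le _
      _ = Real.exp ((∑ j ∈ Finset.range N, ‖w j‖ ^ 2) * ‖z‖ ^ 2 / 2) := by
        rw [← Real.exp_sum, Finset.sum_mul, Finset.sum_div]
        simp only [norm_mul, mul_pow]
      _ ≤ _ := by gcongr

/-- Use $|w|^2=\operatorname{Re}(w^2)+2(\operatorname{Im}w)^2$ and
$0\le\operatorname{Im}w_j\le\operatorname{Im}b$, the latter because all imaginary parts are
nonnegative. -/
theorem sum_norm_sq_le {w : ℕ → ℂ} (him : ∀ j, 0 ≤ (w j).im) {b s : ℂ} (hb : HasSum w b)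
    (hs : HasSum (fun j => w j ^ 2) s) (n : ℕ) :
    ∑ j ∈ Finset.range n, ‖w j‖ ^ 2 ≤ s.re + 2 * b.im ^ 2 := by
  have hbim : HasSum (fun j => (w j).im) b.im := Complex.hasSum_im hb
  have h1 : HasSum (fun j => (w j ^ 2).re + 2 * b.im * (w j).im) (s.re + 2 * b.im ^ 2) := by
    rw [sq, ← mul_assoc]
    exact (Complex.hasSum_re hs).add (hbim.mul_left (2 * b.im))
  have h2 (j : ℕ) : ‖w j‖ ^ 2 ≤ (w j ^ 2).re + 2 * b.im * (w j).im := by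
    have h3 : (w j).im ≤ b.im := le_hasSum hbim j fun k _ => him k
    have h4 : ‖w j‖ ^ 2 = (w j ^ 2).re + 2 * (w j).im * (w j).im := by
      rw [← Complex.normSq_eq_norm_sq, Complex.normSq_apply, sq (w j), Complex.mul_re]
      ring
    rw [h4]
    have := him j
    gcongr
  exact (Finset.sum_le_sum fun j _ => h2 j).trans
    (sum_le_hasSum _ (fun j _ => (sq_nonneg ‖w j‖).trans (h2 j)) h1)

theorem norm_le_sqrt_div_of_antitone {w : ℕ → ℂ} (hanti : Antitone fun j => ‖w j‖) {C : ℝ}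
    (hC : ∀ n, ∑ j ∈ Finset.range n, ‖w j‖ ^ 2 ≤ C) (j : ℕ) : ‖w j‖ ≤ √(C / (j + 1)) := by
  refine Real.le_sqrt_of_sq_le ?_
  rw [le_div_iff₀ (by positivity)]
  calc ‖w j‖ ^ 2 * (j + 1) = ∑ _k ∈ Finset.range (j + 1), ‖w j‖ ^ 2 := by
        rw [Finset.sum_const, Finset.card_range, nsmul_eq_mul, mul_comm]
        push_cast
        ring
    _ ≤ ∑ k ∈ Finset.range (j + 1), ‖w k‖ ^ 2 := by
        refine Finset.sum_le_sum fun k hk => ?_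
        have : ‖w j‖ ≤ ‖w k‖ := hanti (Nat.lt_succ_iff.mp (Finset.mem_range.mp hk))
        gcongr
    _ ≤ C := hC _

theorem UpperRoots.exists_hasProd {p : Polynomial ℂ} (hp : UpperRoots p) (h0 : p.coeff 0 = 1) :
    ∃ w : ℕ → ℂ, (∀ j, 0 ≤ (w j).im) ∧ Antitone (fun j => ‖w j‖) ∧ HasSum w (p.coeff 1) ∧
      HasSum (fun j => w j ^ 2) (p.coeff 1 ^ 2 - 2 * p.coeff 2) ∧
      (∀ z, HasProd (fun j => 1 + w j * z) (p.eval z)) ∧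
      ∀ D : ℝ, (∀ n, ∑ j ∈ Finset.range n, ‖w j‖ ^ 2 ≤ D) → ∀ z,
        ‖p.eval z‖ ≤ Real.exp (‖p.coeff 1‖ * ‖z‖ + D * ‖z‖ ^ 2 / 2) := by
  obtain ⟨N, w, him, hzero, hanti, hprod⟩ := hp.exists_sorted_factorization h0
  obtain ⟨-, h1, h2⟩ := coeff_prod_one_add_C_mul_X w N
  rw [← hprod] at h1 h2
  have hev (z : ℂ) : p.eval z = ∏ j ∈ Finset.range N, (1 + w j * z) := by
    conv_lhs => rw [hprod]
    simp [Polynomial.eval_prod]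
  have hz (j : ℕ) (hj : j ∉ Finset.range N) : w j = 0 := hzero j (by simpa using hj)
  refine ⟨w, him, hanti, ?_, ?_, fun z => ?_, fun D hD z => ?_⟩
  · rw [h1]
    exact hasSum_sum_of_ne_finset_zero hz
  · rw [h2]
    exact hasSum_sum_of_ne_finset_zero fun j hj => by simp [hz j hj]
  · rw [hev]
    exact hasProd_prod_of_ne_finset_one fun j hj => by simp [hz j hj]
  · rw [hev, h1]
    exact norm_prod_one_add_mul_le (hD N) z

/-- Polynomials that are locally bounded uniformly and converge coefficientwise converge
pointwise to an entire function. -/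
theorem exists_hasSum_of_tendsto_coeff {p : ℕ → Polynomial ℂ} {g : ℕ → ℂ}
    (hg : ∀ k, Tendsto (fun i => (p i).coeff k) atTop (𝓝 (g k)))
    {M : ℝ → ℝ} (hM : ∀ i z, ‖(p i).eval z‖ ≤ M ‖z‖) (z : ℂ) :
    Summable (fun k => g k * z ^ k) ∧
      Tendsto (fun i => (p i).eval z) atTop (𝓝 (∑' k, g k * z ^ k)) := by
  -- Cauchy's estimate at this radius gives a geometric majorant of ratio 1/2.
  set R : ℝ := 2 * ‖z‖ + 1
  have hR : 0 < R := by positivity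
  have hcauchy (i k : ℕ) : ‖(p i).coeff k‖ ≤ M R / R ^ k := by
    have h1 := Complex.norm_iteratedDeriv_le_of_forall_mem_sphere_norm_le (c := 0) k hR
      (f := fun z => (p i).eval z) (p i).differentiable.diffContOnCl (C := M R)
      (fun z hz => by
        have h2 := hM i z
        rwa [mem_sphere_zero_iff_norm.mp hz] at h2)
    rw [← taylorCoeff_eval, norm_mul]
    have h3 : (0 : ℝ) < k ! := by exact_mod_cast k.factorial_pos
    simp only [norm_div, norm_one, Complex.norm_natCast]
    calc _ ≤ 1 / (k ! : ℝ) * (k ! * M R / R ^ k) := by gcongr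
      _ = _ := by field_simp
  have hMR : 0 ≤ M R := by
    have := (norm_nonneg _).trans (hcauchy 0 0)
    simpa using this
  have hbound (i k : ℕ) : ‖(p i).coeff k * z ^ k‖ ≤ M R * (1 / 2) ^ k := by
    have h1 : ‖z‖ / R ≤ 1 / 2 := by
      rw [div_le_iff₀ hR]
      simp only [R]
      linarith
    rw [norm_mul, norm_pow]
    calc _ ≤ M R / R ^ k * ‖z‖ ^ k := by gcongr; exact hcauchy i k
      _ = M R * (‖z‖ / R) ^ k := by rw [div_pow]; ring
      _ ≤ _ := by gcongr
  have hsum : Summable fun k => M R * (1 / 2 : ℝ) ^ k := summable_geometric_two.mul_left _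
  have hlim (k : ℕ) : Tendsto (fun i => (p i).coeff k * z ^ k) atTop (𝓝 (g k * z ^ k)) :=
    (hg k).mul_const _
  refine ⟨Summable.of_norm_bounded hsum fun k => le_of_tendsto' (hlim k).norm fun i => hbound i k,
    ?_⟩
  refine (tendsto_tsum_of_dominated_convergence hsum hlim
    (Eventually.of_forall fun i k => hbound i k)).congr fun i => ?_
  rw [Polynomial.eval_eq_sum_range, tsum_eq_sum]
  intro k hk
  rw [Polynomial.coeff_eq_zero_of_natDegree_lt (by simpa [Nat.lt_succ_iff] using hk), zero_mul]

theorem exists_mem_PolyaObrechkoff_of_tendsto_of_coeff_zero {p : ℕ → Polynomial ℂ} {g : ℕ → ℂ}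
    (hp : ∀ i, UpperRoots (p i)) (h0 : ∀ i, (p i).coeff 0 = 1)
    (hg : ∀ k, Tendsto (fun i => (p i).coeff k) atTop (𝓝 (g k))) :
    ∃ F : ℂ → ℂ, (∀ z, HasSum (fun k => g k * z ^ k) (F z)) ∧
      ∀ (c : ℂ) (m : ℕ), (fun z => c * z ^ m * F z) ∈ PolyaObrechkoff := by
  choose w him hanti hb hs hprod hnorm using fun i => (hp i).exists_hasProd (h0 i)
  have hσ : Tendsto (fun i => (p i).coeff 1 ^ 2 - 2 * (p i).coeff 2) atTop
      (𝓝 (g 1 ^ 2 - 2 * g 2)) := ((hg 1).pow 2).sub ((hg 2).const_mul 2)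
  have hD : Tendsto (fun i => ((p i).coeff 1 ^ 2 - 2 * (p i).coeff 2).re +
      2 * ((p i).coeff 1).im ^ 2) atTop (𝓝 ((g 1 ^ 2 - 2 * g 2).re + 2 * (g 1).im ^ 2)) :=
    ((Complex.continuous_re.tendsto _).comp hσ).add
      ((((Complex.continuous_im.tendsto _).comp (hg 1)).pow 2).const_mul 2)
  obtain ⟨C, hC⟩ := hD.bddAbove_range
  obtain ⟨B, hB⟩ := (hg 1).norm.bddAbove_range
  have hC' (i n : ℕ) : ∑ j ∈ Finset.range n, ‖w i j‖ ^ 2 ≤ C :=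
    (sum_norm_sq_le (him i) (hb i) (hs i) n).trans (hC ⟨i, rfl⟩)
  have hB' (i : ℕ) : ‖(p i).coeff 1‖ ≤ B := hB ⟨i, rfl⟩
  have hsqrt (i j : ℕ) : ‖w i j‖ ≤ √(C / (j + 1)) :=
    norm_le_sqrt_div_of_antitone (hanti i) (hC' i) j
  have hM (i : ℕ) (z : ℂ) : ‖(p i).eval z‖ ≤ Real.exp (B * ‖z‖ + C * ‖z‖ ^ 2 / 2) := by
    refine (hnorm i C (hC' i) z).trans (Real.exp_le_exp.mpr ?_)
    gcongr
    exact hB' i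
  have hlim := exists_hasSum_of_tendsto_coeff hg (M := fun r => Real.exp (B * r + C * r ^ 2 / 2)) hM
  -- A subsequence suffices: the limit function is already fixed by the whole sequence.
  obtain ⟨v, -, ns, hns, hv⟩ := (isCompact_univ_pi fun j : ℕ =>
    isCompact_closedBall (0 : ℂ) √(C / (j + 1))).tendsto_subseq (x := w)
    fun i j _ => by simpa using hsqrt i j
  rw [tendsto_pi_nhds] at hv
  have hF (z : ℂ) := (hlim z).1.hasSum
  refine ⟨fun z => ∑' k, g k * z ^ k, hF, fun c m => ?_⟩
  refine mem_PolyaObrechkoff_of_tendsto_prod (w := fun i => w (ns i))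
    (fun i => him (ns i)) (fun i => hsqrt (ns i)) (fun i => hC' (ns i)) hv
    (fun i => hb (ns i)) (fun i => hs (ns i)) ((hg 1).comp hns.tendsto_atTop)
    (hσ.comp hns.tendsto_atTop) (fun z => ?_) (differentiable_of_hasSum hF) c m
  simp_rw [fun i => (hprod (ns i) z).tprod_eq]
  exact (hlim z).2.comp hns.tendsto_atTop

/-! ### Normalisation and conclusion -/

open Polynomial in
theorem exists_mem_PolyaObrechkoff_of_tendsto {p : ℕ → ℂ[X]} {g : ℕ → ℂ}
    (hp : ∀ i, UpperRoots (p i)) (h0 : g 0 = 1)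
    (hg : ∀ k, Tendsto (fun i => (p i).coeff k) atTop (𝓝 (g k))) :
    ∃ F : ℂ → ℂ, (∀ z, HasSum (fun k => g k * z ^ k) (F z)) ∧
      ∀ (c : ℂ) (m : ℕ), (fun z => c * z ^ m * F z) ∈ PolyaObrechkoff := by
  have hne : ∀ᶠ i in atTop, (p i).coeff 0 ≠ 0 :=
    (hg 0).eventually_ne (by rw [h0]; exact one_ne_zero)
  obtain ⟨n, hn⟩ := eventually_atTop.mp hne
  refine exists_mem_PolyaObrechkoff_of_tendsto_of_coeff_zero
    (p := fun i => C ((p (i + n)).coeff 0)⁻¹ * p (i + n))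
    (fun i => (UpperRoots.const _).mul (hp _)) (fun i => ?_) fun k => ?_
  · rw [coeff_C_mul, inv_mul_cancel₀ (hn _ (Nat.le_add_left _ _))]
  · simp only [coeff_C_mul]
    have := (((hg 0).inv₀ (by rw [h0]; exact one_ne_zero)).mul (hg k)).comp
      (tendsto_add_atTop_nat n)
    rwa [h0, inv_one, one_mul] at this

open Polynomial in
-- Approximants of $f$ need not vanish at 0 to the order of $f$, so $z^m$ cannot be divided out of
-- them. Jensen polynomials do inherit the order, which reduces the problem to $a_0=1$.
theorem jensenPolynomial_add_eq {f g : PowerSeries ℂ} {c : ℂ} {m : ℕ}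
    (hlt : ∀ k < m, PowerSeries.coeff k f = 0)
    (hge : ∀ k, PowerSeries.coeff (k + m) f = c * PowerSeries.coeff k g) (n : ℕ) :
    jensenPolynomial f (n + m) =
      C (((n + m)! : ℂ) / (n ! : ℂ) * c) * jensenPolynomial g n * X ^ m := by
  ext k
  rw [coeff_mul_X_pow', coeff_C_mul, jensenPolynomial_coeff, jensenPolynomial_coeff]
  rcases lt_or_ge k m with hk | hk
  · simp [hlt k hk, hk.not_ge]
  · obtain ⟨l, rfl⟩ := Nat.exists_eq_add_of_le' hk
    have h1 : n + m - (l + m) = n - l := by omega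
    have h2 : (n ! : ℂ) ≠ 0 := by exact_mod_cast n.factorial_ne_zero
    rw [if_pos hk, hge, h1, Nat.add_sub_cancel]
    simp only [add_le_add_iff_right]
    split_ifs
    · field_simp
    · simp

open Polynomial in
theorem exists_represents_of_upperRoots_jensenPolynomial {f : PowerSeries ℂ}
    (h : ∀ n, UpperRoots (jensenPolynomial f n)) :
    ∃ F : ℂ → ℂ, F ∈ PolyaObrechkoff ∧ Represents f F := by
  classical
  by_cases hf : ∃ k, PowerSeries.coeff k f ≠ 0
  · set m := Nat.find hf
    set c := PowerSeries.coeff m f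
    have hc : c ≠ 0 := Nat.find_spec hf
    have hlt (k : ℕ) (hk : k < m) : PowerSeries.coeff k f = 0 := not_not.mp (Nat.find_min hf hk)
    let g : PowerSeries ℂ := PowerSeries.mk fun k => c⁻¹ * PowerSeries.coeff (k + m) f
    have hge (k : ℕ) : PowerSeries.coeff (k + m) f = c * PowerSeries.coeff k g := by
      simp [g, hc]
    have hJ (n : ℕ) : UpperRoots (jensenPolynomial g n) := by
      intro z hz hev
      have h1 := h (n + m) z hz
      rw [jensenPolynomial_add_eq hlt hge n] at h1
      have h2 := h1 (by simp [hev])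
      have h3 : ((n + m)! : ℂ) / (n ! : ℂ) * c ≠ 0 :=
        mul_ne_zero (div_ne_zero (by exact_mod_cast Nat.factorial_ne_zero _)
          (by exact_mod_cast Nat.factorial_ne_zero _)) hc
      rw [mul_eq_zero, mul_eq_zero, C_eq_zero] at h2
      exact (h2.resolve_right (pow_ne_zero m X_ne_zero)).resolve_left h3
    obtain ⟨p, hp, hpg⟩ := exists_tendsto_of_upperRoots_jensenPolynomial hJ
    have hg0 : PowerSeries.coeff 0 g = 1 := by
      have : c⁻¹ * PowerSeries.coeff (0 + m) f = 1 := by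
        rw [zero_add]
        exact inv_mul_cancel₀ hc
      rw [PowerSeries.coeff_mk, this]
    obtain ⟨F, hF, hmem⟩ :=
      exists_mem_PolyaObrechkoff_of_tendsto (g := fun k => PowerSeries.coeff k g) hp hg0 hpg
    refine ⟨_, hmem c m, fun z => ?_⟩
    have h1 := (hF z).mul_left (c * z ^ m)
    rw [← hasSum_nat_add_iff' m]
    have h2 : ∑ k ∈ Finset.range m, PowerSeries.coeff k f * z ^ k = 0 :=
      Finset.sum_eq_zero fun k hk => by rw [hlt k (Finset.mem_range.mp hk), zero_mul]
    rw [h2, sub_zero]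
    have h3 : (fun k => PowerSeries.coeff (k + m) f * z ^ (k + m)) =
        fun k => c * z ^ m * (PowerSeries.coeff k g * z ^ k) :=
      funext fun k => by rw [hge, pow_add]; ring
    rw [h3]
    exact h1
  · push Not at hf
    refine ⟨fun _ => 0, ⟨by fun_prop, 0, 0, 0, 0, Empty, inferInstance, Empty.elim, le_rfl,
      fun j => j.elim, Summable.of_finite, Summable.of_finite, by simp, fun z => ⟨1, ?_, by simp⟩⟩,
      fun z => ?_⟩
    · exact hasProd_empty
    · simp [hf]

theorem theorem3p3 (f : PowerSeries ℂ) :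
    List.TFAE [
      ∃ F : ℂ → ℂ, F ∈ PolyaObrechkoff ∧ Represents f F,
      ∃ p : ℕ → Polynomial ℂ,
        ConvergesWeakly (fun n z => (p n).eval z) f ∧
        ∀ n : ℕ, zeroSet (fun z => (p n).eval z) ⊆ closedUpperHalfPlane,
      ∀ n : ℕ, zeroSet (fun z => (jensenPolynomial f n).eval z) ⊆ closedUpperHalfPlane] := by
  simp only [zeroSet_eval_subset_iff, ConvergesWeakly, taylorCoeff_eval]
  tfae_have 1 → 2 := by
    rintro ⟨F, hF, hfF⟩
    obtain ⟨p, hp, hlim⟩ := (mem_closure_upperRootsCoeffs_iff _).mp (taylorCoeff_mem_closure_of_mem_PolyaObrechkoff hF)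
    refine ⟨p, fun k => ?_, hp⟩
    rw [← taylorCoeff_of_hasSum hfF k]
    exact hlim k
  tfae_have 2 → 3 := by
    rintro ⟨p, hlim, hp⟩
    exact upperRoots_jensenPolynomial_of_tendsto hp hlim
  tfae_have 3 → 1 := exists_represents_of_upperRoots_jensenPolynomial
  tfae_finish
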